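/- **Conventions.** For a ring $R$ (associative with identity), modules are left modules of arbitrary size, and $\mathrm{Mod}\text{-}R$ is the category of all $R$-modules. For $T\in\mathrm{Mod}\text{-}R$: $\mathrm{Add}\,T$ is the class of modules isomorphic to a direct summand of a (possibly infinite) direct sum of copies of $T$; $\mathrm{Gen}(T)$ is the class of epimorphic images of modules in $\mathrm{Add}\,T$; $\mathrm{Pres}(T)$ is the class of modules $X$ admitting an exact sequence $M_1\to M_0\to X\to 0$ with $M_0,M_1\in\mathrm{Add}\,T$. The module $T$ is *finendo* if it is finitely generated over its endomorphism ring $\mathrm{End}_R(T)$; it is *quasi-tilting* if $T\in\mathrm{Gen}(T)$, $\mathrm{Ext}^1_R(T,X)=0$ for all $X\in\mathrm{Gen}(T)$, and $\mathrm{Pres}(T)=\mathrm{Gen}(T)$; it is *finendo quasi-tilting* if it is both. **Setup.** Let $k$ be an algebraically closed field, $B$ a finite dimensional $k$-algebra, $P_0$ a finitely generated projective $B$-module, and let $$A=B[P_0]=\begin{pmatrix}B&P_0\\0&k\end{pmatrix}$$ be the one-point extension. Let $e_B=\begin{pmatrix}1&0\\0&0\end{pmatrix}$, identify $B$ with $e_BAe_B$,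 and let $$\mathcal R=\mathrm{Hom}_A(Ae_B,-):\mathrm{Mod}\text{-}A\to\mathrm{Mod}\text{-}B,\qquad \mathcal E=\mathrm{Hom}_B(e_BA,-):\mathrm{Mod}\text{-}B\to\mathrm{Mod}\text{-}A$$ be the restriction and extension functors. Let $S$ be the simple $A$-module $k$ on which $A$ acts through the projection $A\to k$, $\begin{pmatrix}b&p\\0&c\end{pmatrix}\mapsto c$; equivalently, $S$ is the top of the projective $A$-module $\tilde P=A\begin{pmatrix}0&0\\0&1\end{pmatrix}$. **Theorem.** 1. If $T$ is a finendo quasi-tilting $A$-module, then $\mathcal R T$ is a finendo quasi-tilting $B$-module. 2. If $T'$ is a finendo quasi-tilting $B$-module, then $\mathcal E T'\oplus S$ is a finendo quasi-tilting $A$-module. -/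

import Mathlib

open CategoryTheory

universe u

set_option linter.unusedSectionVars false
set_option linter.unusedVariables false

/-! ### Modules over an arbitrary ring: `Add T`, `Gen T`, `Pres T`, finendo quasi-tilting modules -/

namespace QuasiTilting

variable {R : Type u} [Ring R]

/-- `Add T`: the modules isomorphic to a direct summand of a direct sum `T^(I)` of copies of `T`.
A direct summand is given by a split inclusion `i` with retraction `p`. -/
def AddOf (T : ModuleCat.{u} R) : ObjectProperty (ModuleCat.{u} R) := fun X =>
  ∃ (I : Type u) (i : X →ₗ[R] (I →₀ T)) (p : (I →₀ T) →ₗ[R] X), p ∘ₗ i = LinearMap.id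

/-- `Gen T`: the epimorphic images of modules in `Add T`. -/
def Gen (T : ModuleCat.{u} R) : ObjectProperty (ModuleCat.{u} R) := fun X =>
  ∃ (M : ModuleCat.{u} R) (f : M →ₗ[R] X), AddOf T M ∧ Function.Surjective f

/-- `Pres T`: the modules `X` with an exact sequence `M₁ → M₀ → X → 0`, `M₁, M₀ ∈ Add T`. -/
def Pres (T : ModuleCat.{u} R) : ObjectProperty (ModuleCat.{u} R) := fun X =>
  ∃ (M₁ M₀ : ModuleCat.{u} R) (f : M₁ →ₗ[R] M₀) (g : M₀ →ₗ[R] X),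
    AddOf T M₁ ∧ AddOf T M₀ ∧ Function.Exact f g ∧ Function.Surjective g

/-- `T` is Ext-projective in the class `𝒳`: `T ∈ 𝒳` and `Ext¹(T, X) = 0` for all `X ∈ 𝒳`. -/
def IsExtProjective (𝒳 : ObjectProperty (ModuleCat.{u} R)) (T : ModuleCat.{u} R) : Prop :=
  𝒳 T ∧ ∀ X : ModuleCat.{u} R, 𝒳 X → Subsingleton (Abelian.Ext T X 1)

/-- `T` is finitely generated over its endomorphism ring. -/
def IsFinendo (T : ModuleCat.{u} R) : Prop :=
  Module.Finite (Module.End R T) T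

/-- `T` is Ext-projective in `Gen T`, and `Pres T = Gen T`. -/
def IsQuasiTilting (T : ModuleCat.{u} R) : Prop :=
  IsExtProjective (Gen T) T ∧ Pres T = Gen T

/-- `T` is both finendo and quasi-tilting. -/
def IsFinendoQuasiTilting (T : ModuleCat.{u} R) : Prop :=
  IsFinendo T ∧ IsQuasiTilting T

end QuasiTilting

/-! ### The one-point extension -/

/-- The underlying set of the one-point extension `B[P₀]`: the upper triangular matrices
`(b p; 0 c)` with `b ∈ B`, `p ∈ P₀`, `c ∈ k`. -/
@[ext]
structure OnePointExt (k B P₀ : Type u) where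
  b : B
  p : P₀
  c : k

namespace OnePointExt

section Ring

variable {k B P₀ : Type u} [Field k] [Ring B] [Algebra k B] [AddCommGroup P₀] [Module k P₀]
  [Module B P₀]

instance : Zero (OnePointExt k B P₀) := ⟨⟨0, 0, 0⟩⟩
instance : One (OnePointExt k B P₀) := ⟨⟨1, 0, 1⟩⟩
instance : Add (OnePointExt k B P₀) := ⟨fun x y => ⟨x.b + y.b, x.p + y.p, x.c + y.c⟩⟩
instance : Neg (OnePointExt k B P₀) := ⟨fun x => ⟨-x.b, -x.p, -x.c⟩⟩

/-- Matrix multiplication `(b p; 0 c) (b' p'; 0 c') = (bb' bp'+pc'; 0 cc')`. -/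
instance : Mul (OnePointExt k B P₀) :=
  ⟨fun x y => ⟨x.b * y.b, x.b • y.p + y.c • x.p, x.c * y.c⟩⟩

@[simp] lemma zero_b : (0 : OnePointExt k B P₀).b = 0 := rfl
@[simp] lemma zero_p : (0 : OnePointExt k B P₀).p = 0 := rfl
@[simp] lemma zero_c : (0 : OnePointExt k B P₀).c = 0 := rfl
@[simp] lemma one_b : (1 : OnePointExt k B P₀).b = 1 := rfl
@[simp] lemma one_p : (1 : OnePointExt k B P₀).p = 0 := rfl
@[simp] lemma one_c : (1 : OnePointExt k B P₀).c = 1 := rfl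
@[simp] lemma add_b (x y : OnePointExt k B P₀) : (x + y).b = x.b + y.b := rfl
@[simp] lemma add_p (x y : OnePointExt k B P₀) : (x + y).p = x.p + y.p := rfl
@[simp] lemma add_c (x y : OnePointExt k B P₀) : (x + y).c = x.c + y.c := rfl
@[simp] lemma neg_b (x : OnePointExt k B P₀) : (-x).b = -x.b := rfl
@[simp] lemma neg_p (x : OnePointExt k B P₀) : (-x).p = -x.p := rfl
@[simp] lemma neg_c (x : OnePointExt k B P₀) : (-x).c = -x.c := rfl
@[simp] lemma mul_b (x y : OnePointExt k B P₀) : (x * y).b = x.b * y.b := rfl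
@[simp] lemma mul_p (x y : OnePointExt k B P₀) :
    (x * y).p = x.b • y.p + y.c • x.p := rfl
@[simp] lemma mul_c (x y : OnePointExt k B P₀) : (x * y).c = x.c * y.c := rfl

variable [IsScalarTower k B P₀]

/-- The ring `B[P₀]`. -/
instance : Ring (OnePointExt k B P₀) where
  add_assoc x y z := by ext <;> simp [add_assoc]
  zero_add x := by ext <;> simp
  add_zero x := by ext <;> simp
  add_comm x y := by ext <;> simp [add_comm]
  neg_add_cancel x := by ext <;> simp
  left_distrib x y z := by ext <;> simp [mul_add, add_smul]; abel
  right_distrib x y z := by ext <;> simp [add_mul, add_smul]; abel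
  zero_mul x := by ext <;> simp
  mul_zero x := by ext <;> simp
  mul_assoc x y z := by
    ext
    · simp [mul_assoc]
    · simp [mul_smul, add_assoc, smul_comm x.b z.c y.p, smul_comm z.c y.c x.p]
    · simp [mul_assoc]
  one_mul x := by ext <;> simp
  mul_one x := by ext <;> simp
  nsmul := nsmulRec
  zsmul := zsmulRec

end Ring

variable (k B P₀ : Type u) [Field k] [Ring B] [Algebra k B] [AddCommGroup P₀] [Module k P₀]
  [Module B P₀] [IsScalarTower k B P₀]

/-- The inclusion `B = e_B A e_B ⊆ A`, a ring homomorphism up to the unit, `1 ↦ e_B`. -/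
def incl : B →ₙ+* OnePointExt k B P₀ where
  toFun b := ⟨b, 0, 0⟩
  map_mul' x y := by ext <;> simp
  map_zero' := rfl
  map_add' x y := by ext <;> simp

/-- The idempotent `e_B = (1 0; 0 0)`, the identity of `B`. -/
def eB : OnePointExt k B P₀ := ⟨1, 0, 0⟩

/-- The idempotent `(0 0; 0 1)` of the extension vertex. -/
def eK : OnePointExt k B P₀ := ⟨0, 0, 1⟩

/-- The left ideal `A e_B`. -/
def AeB : Submodule (OnePointExt k B P₀) (OnePointExt k B P₀) :=
  LinearMap.range (LinearMap.toSpanSingleton (OnePointExt k B P₀) (OnePointExt k B P₀) (eB k B P₀))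

/-- The right ideal `e_B A`. -/
def eBA : AddSubgroup (OnePointExt k B P₀) :=
  (AddMonoidHom.mulLeft (eB k B P₀)).range

variable {k B P₀}

@[simp] lemma incl_b (b : B) : (incl k B P₀ b).b = b := rfl
@[simp] lemma incl_p (b : B) : (incl k B P₀ b).p = 0 := rfl
@[simp] lemma incl_c (b : B) : (incl k B P₀ b).c = 0 := rfl

lemma incl_one : incl k B P₀ 1 = eB k B P₀ := rfl

lemma mul_eB_of_mem {x : OnePointExt k B P₀} (hx : x ∈ AeB k B P₀) : x * eB k B P₀ = x := by
  obtain ⟨a, rfl⟩ := hx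
  ext <;> simp [eB]

lemma eB_mul_of_mem {x : OnePointExt k B P₀} (hx : x ∈ eBA k B P₀) : eB k B P₀ * x = x := by
  obtain ⟨a, rfl⟩ := hx
  ext <;> simp [eB]

lemma mul_incl_mem (x : OnePointExt k B P₀) (b : B) : x * incl k B P₀ b ∈ AeB k B P₀ :=
  ⟨x * incl k B P₀ b, by ext <;> simp [eB]⟩

lemma incl_mul_mem (b : B) (x : OnePointExt k B P₀) : incl k B P₀ b * x ∈ eBA k B P₀ :=
  ⟨incl k B P₀ b * x, by ext <;> simp [eB]⟩

lemma mul_mem_eBA {x : OnePointExt k B P₀} (hx : x ∈ eBA k B P₀) (a : OnePointExt k B P₀) :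
    x * a ∈ eBA k B P₀ := by
  obtain ⟨y, rfl⟩ := hx
  exact ⟨y * a, by simp [mul_assoc]⟩

/-- Right multiplication by `b ∈ B` on the `A`-`B`-bimodule `A e_B`. -/
def rightMulAeB (b : B) : AeB k B P₀ →ₗ[OnePointExt k B P₀] AeB k B P₀ where
  toFun x := ⟨x.1 * incl k B P₀ b, mul_incl_mem _ _⟩
  map_add' x y := Subtype.ext (add_mul _ _ _)
  map_smul' a x := Subtype.ext (mul_assoc _ _ _)

/-- The left `B`-module structure of the `B`-`A`-bimodule `e_B A`. -/
instance : Module B (eBA k B P₀) where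
  smul b x := ⟨incl k B P₀ b * x.1, incl_mul_mem _ _⟩
  one_smul x := Subtype.ext (eB_mul_of_mem x.2)
  mul_smul b b' x := Subtype.ext (by
    change incl k B P₀ (b * b') * x.1 = incl k B P₀ b * (incl k B P₀ b' * x.1)
    rw [map_mul, mul_assoc])
  smul_zero b := Subtype.ext (mul_zero _)
  smul_add b x y := Subtype.ext (mul_add _ _ _)
  add_smul b b' x := Subtype.ext (by
    change incl k B P₀ (b + b') * x.1 = incl k B P₀ b * x.1 + incl k B P₀ b' * x.1
    rw [map_add, add_mul])
  zero_smul x := Subtype.ext (by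
    change incl k B P₀ 0 * x.1 = 0
    rw [map_zero, zero_mul])

/-- Right multiplication by `a ∈ A` on the `B`-`A`-bimodule `e_B A`. -/
def rightMulEBA (a : OnePointExt k B P₀) : eBA k B P₀ →ₗ[B] eBA k B P₀ where
  toFun x := ⟨x.1 * a, mul_mem_eBA x.2 a⟩
  map_add' x y := Subtype.ext (add_mul _ _ _)
  map_smul' b x := Subtype.ext (mul_assoc _ _ _)

variable (k B P₀)

/-- The underlying group of `Hom_A(A e_B, X)`. -/
def Restr (X : Type u) [AddCommGroup X] [Module (OnePointExt k B P₀) X] : Type u :=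
  AeB k B P₀ →ₗ[OnePointExt k B P₀] X

instance (X : Type u) [AddCommGroup X] [Module (OnePointExt k B P₀) X] :
    AddCommGroup (Restr k B P₀ X) :=
  inferInstanceAs (AddCommGroup (AeB k B P₀ →ₗ[OnePointExt k B P₀] X))

/-- `B` acts on `Hom_A(A e_B, X)` by `(b • f) x = f (x b)`. -/
instance (X : Type u) [AddCommGroup X] [Module (OnePointExt k B P₀) X] :
    Module B (Restr k B P₀ X) where
  smul b f := LinearMap.comp f (rightMulAeB b)
  one_smul f := LinearMap.ext fun x =>
    congrArg (DFunLike.coe (F := AeB k B P₀ →ₗ[OnePointExt k B P₀] X) f)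
      (Subtype.ext (mul_eB_of_mem x.2))
  mul_smul b b' f := LinearMap.ext fun x =>
    congrArg (DFunLike.coe (F := AeB k B P₀ →ₗ[OnePointExt k B P₀] X) f) (Subtype.ext (by
      change x.1 * incl k B P₀ (b * b') = x.1 * incl k B P₀ b * incl k B P₀ b'
      rw [map_mul, mul_assoc]))
  smul_zero b := rfl
  smul_add b f g := rfl
  add_smul b b' f := LinearMap.ext fun x =>
    (congrArg (DFunLike.coe (F := AeB k B P₀ →ₗ[OnePointExt k B P₀] X) f) (Subtype.ext (by
      change x.1 * incl k B P₀ (b + b') = x.1 * incl k B P₀ b + x.1 * incl k B P₀ b'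
      rw [map_add, mul_add]) :
        rightMulAeB (b + b') x = rightMulAeB b x + rightMulAeB b' x)).trans
      (LinearMap.map_add _ _ _)
  zero_smul f := LinearMap.ext fun x =>
    (congrArg (DFunLike.coe (F := AeB k B P₀ →ₗ[OnePointExt k B P₀] X) f) (Subtype.ext (by
      change x.1 * incl k B P₀ 0 = 0
      rw [map_zero, mul_zero]) : rightMulAeB 0 x = 0)).trans
      (LinearMap.map_zero _)

/-- The underlying group of `Hom_B(e_B A, M)`. -/
def Exten (M : Type u) [AddCommGroup M] [Module B M] : Type u :=
  eBA k B P₀ →ₗ[B] M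

instance (M : Type u) [AddCommGroup M] [Module B M] : AddCommGroup (Exten k B P₀ M) :=
  inferInstanceAs (AddCommGroup (eBA k B P₀ →ₗ[B] M))

/-- `A` acts on `Hom_B(e_B A, M)` by `(a • f) x = f (x a)`. -/
instance (M : Type u) [AddCommGroup M] [Module B M] :
    Module (OnePointExt k B P₀) (Exten k B P₀ M) where
  smul a f := LinearMap.comp f (rightMulEBA a)
  one_smul f := LinearMap.ext fun x =>
    congrArg (DFunLike.coe (F := eBA k B P₀ →ₗ[B] M) f) (Subtype.ext (mul_one x.1))
  mul_smul a a' f := LinearMap.ext fun x =>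
    congrArg (DFunLike.coe (F := eBA k B P₀ →ₗ[B] M) f) (Subtype.ext (mul_assoc x.1 a a').symm)
  smul_zero a := rfl
  smul_add a f g := rfl
  add_smul a a' f := LinearMap.ext fun x =>
    (congrArg (DFunLike.coe (F := eBA k B P₀ →ₗ[B] M) f) (Subtype.ext (mul_add x.1 a a') :
        rightMulEBA (a + a') x = rightMulEBA a x + rightMulEBA a' x)).trans
      (LinearMap.map_add _ _ _)
  zero_smul f := LinearMap.ext fun x =>
    (congrArg (DFunLike.coe (F := eBA k B P₀ →ₗ[B] M) f) (Subtype.ext (mul_zero x.1) :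
        rightMulEBA 0 x = 0)).trans
      (LinearMap.map_zero _)

/-- The restriction functor `ℛ = Hom_A(A e_B, -) : Mod-A ⥤ Mod-B`. -/
def restriction : ModuleCat.{u} (OnePointExt k B P₀) ⥤ ModuleCat.{u} B where
  obj X := ModuleCat.of B (Restr k B P₀ X)
  map {X Y} g := ModuleCat.ofHom (X := Restr k B P₀ X) (Y := Restr k B P₀ Y)
    { toFun := fun f => LinearMap.comp g.hom f
      map_add' := fun f f' => LinearMap.comp_add _ _ _
      map_smul' := fun _ _ => rfl }

/-- The extension functor `ℰ = Hom_B(e_B A, -) : Mod-B ⥤ Mod-A`. -/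
def extension : ModuleCat.{u} B ⥤ ModuleCat.{u} (OnePointExt k B P₀) where
  obj M := ModuleCat.of (OnePointExt k B P₀) (Exten k B P₀ M)
  map {M N} g := ModuleCat.ofHom (X := Exten k B P₀ M) (Y := Exten k B P₀ N)
    { toFun := fun f => LinearMap.comp g.hom f
      map_add' := fun f f' => LinearMap.comp_add _ _ _
      map_smul' := fun _ _ => rfl }

/-- The ring homomorphism `A → k`, `(b p; 0 c) ↦ c`. -/
def toK : OnePointExt k B P₀ →+* k where
  toFun := c
  map_one' := rfl
  map_mul' _ _ := rfl
  map_zero' := rfl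
  map_add' _ _ := rfl

/-- The simple `A`-module `S`: the field `k`, on which `A` acts through `A → k`. It is the top of
the projective `A`-module `P̃ = A (0 0; 0 1)`, see `nonempty_top_equiv_simpleS`. -/
def simpleS : ModuleCat.{u} (OnePointExt k B P₀) :=
  letI := Module.compHom k (toK k B P₀)
  ModuleCat.of (OnePointExt k B P₀) k

/-- The projective `A`-module `P̃ = A (0 0; 0 1)`. -/
def Ptilde : Submodule (OnePointExt k B P₀) (OnePointExt k B P₀) :=
  LinearMap.range (LinearMap.toSpanSingleton (OnePointExt k B P₀) (OnePointExt k B P₀) (eK k B P₀))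

/-- `S` is the top `P̃ / rad P̃` of `P̃`, where `rad` is the intersection of the maximal submodules. -/
lemma nonempty_top_equiv_simpleS :
    Nonempty ((Ptilde k B P₀ ⧸ Module.jacobson (OnePointExt k B P₀) (Ptilde k B P₀))
      ≃ₗ[OnePointExt k B P₀] simpleS k B P₀) := by
  let φ : Ptilde k B P₀ →ₗ[OnePointExt k B P₀] simpleS k B P₀ :=
    { toFun := fun x => x.1.c
      map_add' := fun _ _ => rfl
      map_smul' := fun _ _ => rfl }
  have hb : ∀ y : Ptilde k B P₀, y.1.b = 0 := by
    rintro ⟨_, a, rfl⟩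
    simp [eK]
  have heK : eK k B P₀ ∈ Ptilde k B P₀ := ⟨1, by simp⟩
  have key : ∀ (N : Submodule (OnePointExt k B P₀) (Ptilde k B P₀)) (y : Ptilde k B P₀),
      y ∈ N → y.1.c ≠ 0 → N = ⊤ := by
    intro N y hy hc
    have h1 : (⟨eK k B P₀, heK⟩ : Ptilde k B P₀) ∈ N := by
      convert N.smul_mem (⟨0, 0, (y.1.c)⁻¹⟩ : OnePointExt k B P₀) hy
      ext <;> simp [eK, hb, hc]
    rw [eq_top_iff]
    rintro ⟨_, a, rfl⟩ -
    exact N.smul_mem a h1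
  have hsurj : Function.Surjective φ := fun (c : k) =>
    ⟨⟨⟨0, 0, c⟩, ⟨⟨0, 0, c⟩, by ext <;> simp [eK]⟩⟩, rfl⟩
  have hker : Module.jacobson (OnePointExt k B P₀) (Ptilde k B P₀) = LinearMap.ker φ := by
    apply le_antisymm
    · refine sInf_le ⟨fun h => ?_, fun N hN => ?_⟩
      · have : (⟨eK k B P₀, heK⟩ : Ptilde k B P₀) ∈ LinearMap.ker φ := h ▸ Submodule.mem_top
        exact one_ne_zero (α := k) this
      · obtain ⟨y, hy, hyk⟩ := SetLike.exists_of_lt hN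
        exact key N y hy hyk
    · refine le_sInf fun m hm => ?_
      by_contra hle
      have h : m ⊔ LinearMap.ker φ = ⊤ := hm.2 _ (left_lt_sup.2 hle)
      obtain ⟨y, hy, z, hz, hyz⟩ := Submodule.mem_sup.1
        (h ▸ Submodule.mem_top : (⟨eK k B P₀, heK⟩ : Ptilde k B P₀) ∈ m ⊔ LinearMap.ker φ)
      have hz' : z.1.c = 0 := hz
      have hc : y.1.c + z.1.c = 1 := congrArg (fun w : Ptilde k B P₀ => w.1.c) hyz
      exact hm.1 (key m y hy (by rw [hz', add_zero] at hc; rw [hc]; exact one_ne_zero))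
  exact ⟨(Submodule.quotEquivOfEq _ _ hker).trans (φ.quotKerEquivOfSurjective hsurj)⟩

end OnePointExt

/-!
An `A`-module `X` over `A = B[P₀]` amounts to the `B`-module `ℛ X = e_B X`, the vector space
`V = (1 - e_B) X` and a map `V → Hom_B(P₀, ℛ X)`. As `P₀` is finitely generated projective, so is
`e_B A ≅ B ⊕ P₀` over `B`; hence both `ℛ` and its right adjoint `ℰ` are exact and commute with
direct sums, and `ℛℰ ≅ 1`. The kernel of the unit `X → ℰℛ X` is annihilated by `e_B`, and so is
its cokernel. A module annihilated by `e_B` is a direct sum of copies of `S`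
(`OnePointExt.addOf_simpleS`), and it is injective, so that its first extension groups vanish
(`OnePointExt.extVanishes_of_eB_smul_eq_zero`).

The vanishing of `Ext¹` is used throughout as a lifting property
(`QuasiTilting.subsingleton_ext_iff`), which is transported along the adjunction:

* if `Ext¹_A(T, ℰ N) = 0` then `Ext¹_B(ℛ T, N) = 0` (`OnePointExt.extVanishes_restr`);
* if the unit of `X` is surjective and `Ext¹_B(ℛ T, ℛ X) = 0`, then `Ext¹_A(T, X) = 0`
  (`OnePointExt.extVanishes_of_restr`).

Restriction. Let `T` be quasi-tilting over `A` and `Y ∈ Gen (ℛ T)`. The adjunct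
`T^(I) → ℰ Y` of an epimorphism `ℛ T^(I) → Y` has an image `X ∈ Gen T` with `ℛ X ≅ Y` and with
`ℰ Y / X` annihilated by `e_B` (`OnePointExt.exists_submodule_exten`). So `Ext¹_A(T, -)` vanishes
on `X` and on `ℰ Y / X`, hence on `ℰ Y`, which gives `Ext¹_B(ℛ T, Y) = 0`; and `ℛ` carries a
presentation of `X` in `Add T` to one of `Y` in `Add (ℛ T)`.

Extension. Let `T = ℰ T' ⊕ S`. Then `ℛ T ≅ T'`, and the unit of `T` is surjective, hence so is
that of every `X ∈ Gen T` (`OnePointExt.unit_surjective_of_gen`). As `ℛ X ∈ Gen T'`, this gives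
`Ext¹_A(T, X) = 0`. The kernel `K` of the unit of `X` is injective, so `X ≅ K ⊕ ℰℛ X`, where
`K ∈ Add S` and `ℰℛ X` is presented by the image under `ℰ` of a presentation of `ℛ X` in
`Add T'`.

Finite generation over endomorphism rings is transported directly; for `ℰ T'` it holds because
`Hom_B(e_B A, T')` is a direct summand of some `T'ⁿ` (`OnePointExt.exists_pi_exten`).
-/

/-! ### Vanishing of `Ext¹` as a lifting property -/

namespace QuasiTilting

section General

variable {R : Type u} [Ring R]

/-- The lifting form of `Ext¹(T, X) = 0`: whenever `X` is the kernel of a map `g : Z → W`, every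
map `T → W` with values in the image of `g` lifts along `g`. -/
def ExtVanishes (R : Type u) [Ring R] (T X : Type u) [AddCommGroup T] [Module R T]
    [AddCommGroup X] [Module R X] : Prop :=
  ∀ (Z W : Type u) [AddCommGroup Z] [AddCommGroup W] [Module R Z] [Module R W]
    (i : X →ₗ[R] Z) (g : Z →ₗ[R] W), Function.Injective i → Function.Exact i g →
    ∀ h : T →ₗ[R] W, (∀ t, h t ∈ LinearMap.range g) → ∃ l : T →ₗ[R] Z, g ∘ₗ l = h

theorem subsingleton_ext_iff (T X : ModuleCat.{u} R) :
    Subsingleton (Abelian.Ext T X 1) ↔ ExtVanishes R T X := by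
  constructor
  · intro hs Z W _ _ _ _ i g hi hg h hh
    -- corestricting `g` to its image gives a short exact sequence
    have hr : Function.Surjective g.rangeRestrict := g.surjective_rangeRestrict
    let S : ShortComplex (ModuleCat.{u} R) :=
      ShortComplex.mk (ModuleCat.ofHom i) (ModuleCat.ofHom g.rangeRestrict) (by
        refine ModuleCat.hom_ext (LinearMap.ext fun x => Subtype.ext ?_)
        exact hg.apply_apply_eq_zero x)
    have hS : S.ShortExact := ModuleCat.shortComplex_shortExact S
      (fun z => by
        refine Iff.trans ?_ (hg z)
        exact Subtype.ext_iff) hi hr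
    let h₀ : T ⟶ S.X₃ := ModuleCat.ofHom (h.codRestrict _ hh)
    obtain ⟨x, hx⟩ := Abelian.Ext.covariant_sequence_exact₃ T hS (Abelian.Ext.mk₀ h₀)
      (zero_add 1) (Subsingleton.elim _ _)
    obtain ⟨l, rfl⟩ := Abelian.Ext.homEquiv₀.symm.surjective x
    have hl : l ≫ S.g = h₀ := by
      apply Abelian.Ext.homEquiv₀.symm.injective
      simpa using hx
    refine ⟨l.hom, LinearMap.ext fun t => ?_⟩
    exact congrArg Subtype.val (congrArg (fun f => f.hom t) hl)
  · intro hT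
    obtain ⟨⟨I, hI, ι, hm⟩⟩ := EnoughInjectives.presentation X
    have hι : Function.Injective ι.hom := (ModuleCat.mono_iff_injective ι).1 inferInstance
    let q := (LinearMap.range ι.hom).mkQ
    have hq : Function.Exact ι.hom q := LinearMap.exact_map_mkQ_range _
    let S : ShortComplex (ModuleCat.{u} R) :=
      ShortComplex.mk ι (ModuleCat.ofHom q) (by
        ext x
        exact hq.apply_apply_eq_zero x)
    have hS : S.ShortExact := ModuleCat.shortComplex_shortExact S hq hι
      (Submodule.mkQ_surjective _)
    refine subsingleton_of_forall_eq 0 fun e => ?_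
    have : Injective S.X₂ := hI
    obtain ⟨x, rfl⟩ := Abelian.Ext.covariant_sequence_exact₁ T hS e
      (Abelian.Ext.eq_zero_of_injective _) (zero_add 1)
    obtain ⟨h, rfl⟩ := Abelian.Ext.homEquiv₀.symm.surjective x
    obtain ⟨l, hl⟩ := hT _ _ ι.hom q hι hq h.hom
      (fun t => (Submodule.mkQ_surjective _ (h.hom t)))
    obtain ⟨l', rfl⟩ : ∃ l' : T ⟶ S.X₂, l' ≫ S.g = h :=
      ⟨ModuleCat.ofHom l, ModuleCat.hom_ext hl⟩
    rw [Abelian.Ext.homEquiv₀_symm_apply, ← Abelian.Ext.mk₀_comp_mk₀,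
      Abelian.Ext.comp_assoc_of_second_deg_zero, hS.comp_extClass, Abelian.Ext.comp_zero]

variable {T T' X Y : Type u} [AddCommGroup T] [Module R T] [AddCommGroup T'] [Module R T']
  [AddCommGroup X] [Module R X] [AddCommGroup Y] [Module R Y]

theorem ExtVanishes.congr_left (e : T ≃ₗ[R] T') (h : ExtVanishes R T X) : ExtVanishes R T' X := by
  intro Z W _ _ _ _ i g hi hg f hf
  obtain ⟨l, hl⟩ := h Z W i g hi hg (f ∘ₗ e.toLinearMap) fun t => hf (e t)
  refine ⟨l ∘ₗ e.symm.toLinearMap, LinearMap.ext fun t => ?_⟩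
  simpa using LinearMap.congr_fun hl (e.symm t)

/-- The vanishing of `Ext¹(T, -)` is closed under extensions. -/
theorem ExtVanishes.of_submodule (N : Submodule R X) (h₁ : ExtVanishes R T N)
    (h₂ : ExtVanishes R T (X ⧸ N)) : ExtVanishes R T X := by
  intro Z W _ _ _ _ i g hi hg f hf
  have hle : N.map i ≤ LinearMap.ker g := by
    rintro _ ⟨x, -, rfl⟩
    exact hg.apply_apply_eq_zero x
  -- lift first to `Z / N`, then to `Z`
  obtain ⟨l, hl⟩ := h₂ (Z ⧸ N.map i) W (N.mapQ (N.map i) i (Submodule.le_comap_map i N))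
    ((N.map i).liftQ g hle) (by
      rw [injective_iff_map_eq_zero]
      intro x hx
      obtain ⟨x, rfl⟩ := N.mkQ_surjective x
      simp only [Submodule.mkQ_apply, Submodule.mapQ_apply, Submodule.Quotient.mk_eq_zero] at hx ⊢
      obtain ⟨n, hn, hnx⟩ := hx
      rwa [← hi hnx])
    (by
      intro z
      obtain ⟨z, rfl⟩ := (N.map i).mkQ_surjective z
      simp only [Submodule.mkQ_apply, Submodule.liftQ_apply]
      refine ⟨fun hz => ?_, ?_⟩
      · obtain ⟨x, rfl⟩ := (hg z).1 hz
        exact ⟨N.mkQ x, by simp⟩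
      · rintro ⟨x, hx⟩
        obtain ⟨x, rfl⟩ := N.mkQ_surjective x
        simp only [Submodule.mkQ_apply, Submodule.mapQ_apply] at hx
        have h3 := congrArg ((N.map i).liftQ g hle) hx
        simp only [Submodule.liftQ_apply] at h3
        rw [← h3]
        exact hg.apply_apply_eq_zero x)
    f (fun t => by
      obtain ⟨z, hz⟩ := hf t
      exact ⟨(N.map i).mkQ z, by simpa using hz⟩)
  obtain ⟨l', hl'⟩ := h₁ Z (Z ⧸ N.map i) (i ∘ₗ N.subtype) (N.map i).mkQ
    (hi.comp N.injective_subtype) (by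
      have : N.map i = LinearMap.range (i ∘ₗ N.subtype) := by
        rw [LinearMap.range_comp, Submodule.range_subtype]
      intro z
      rw [Submodule.mkQ_apply, Submodule.Quotient.mk_eq_zero, this]
      rfl)
    l (fun t => by rw [Submodule.range_mkQ]; trivial)
  refine ⟨l', ?_⟩
  rw [← hl, ← hl', ← LinearMap.comp_assoc, Submodule.liftQ_mkQ]

/-! ### Closure properties of `Add T` and `Gen T` -/

theorem addOf_finsupp (T : ModuleCat.{u} R) (I : Type u) :
    AddOf T (ModuleCat.of R (I →₀ T)) :=
  ⟨I, LinearMap.id, LinearMap.id, rfl⟩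

theorem addOf_self (T : ModuleCat.{u} R) : AddOf T T :=
  ⟨PUnit, Finsupp.lsingle PUnit.unit, Finsupp.lapply PUnit.unit, by ext; simp⟩

theorem addOf_mono {T T' X : ModuleCat.{u} R} (i : T →ₗ[R] T') (p : T' →ₗ[R] T)
    (hpi : p ∘ₗ i = LinearMap.id) (h : AddOf T X) : AddOf T' X := by
  obtain ⟨I, j, q, hqj⟩ := h
  refine ⟨I, Finsupp.mapRange.linearMap i ∘ₗ j, q ∘ₗ Finsupp.mapRange.linearMap p, ?_⟩
  rw [LinearMap.comp_assoc, ← LinearMap.comp_assoc j, ← Finsupp.mapRange.linearMap_comp, hpi,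
    Finsupp.mapRange.linearMap_id, LinearMap.id_comp, hqj]

theorem addOf_prod {T X Y : ModuleCat.{u} R} (hX : AddOf T X) (hY : AddOf T Y) :
    AddOf T (ModuleCat.of R (X × Y)) := by
  obtain ⟨I, i, p, hi⟩ := hX
  obtain ⟨J, j, q, hj⟩ := hY
  refine ⟨I ⊕ J, (Finsupp.sumFinsuppLEquivProdFinsupp R).symm.toLinearMap ∘ₗ i.prodMap j,
    p.prodMap q ∘ₗ (Finsupp.sumFinsuppLEquivProdFinsupp R).toLinearMap, ?_⟩
  refine LinearMap.ext fun x => ?_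
  have h1 := LinearMap.congr_fun hi x.1
  have h2 := LinearMap.congr_fun hj x.2
  simp only [LinearMap.comp_apply, LinearEquiv.coe_coe, LinearEquiv.apply_symm_apply,
    LinearMap.prodMap_apply, LinearMap.id_apply] at h1 h2 ⊢
  exact Prod.ext h1 h2

theorem gen_iff {T X : ModuleCat.{u} R} :
    Gen T X ↔ ∃ (I : Type u) (f : (I →₀ T) →ₗ[R] X), Function.Surjective f := by
  constructor
  · rintro ⟨M, f, ⟨I, i, p, hpi⟩, hf⟩
    refine ⟨I, f ∘ₗ p, hf.comp fun m => ⟨i m, LinearMap.congr_fun hpi m⟩⟩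
  · rintro ⟨I, f, hf⟩
    exact ⟨_, f, addOf_finsupp T I, hf⟩

theorem gen_self (T : ModuleCat.{u} R) : Gen T T :=
  ⟨T, LinearMap.id, addOf_self T, Function.surjective_id⟩

theorem pres_le_gen (T : ModuleCat.{u} R) : Pres T ≤ Gen T :=
  fun _ ⟨_, M₀, _, g, _, h₀, _, hg⟩ => ⟨M₀, g, h₀, hg⟩

/-- A quasi-tilting module, with `Ext¹` in its lifting form. -/
theorem isQuasiTilting_iff {T : ModuleCat.{u} R} :
    IsQuasiTilting T ↔ ∀ X : ModuleCat.{u} R, Gen T X → ExtVanishes R T X ∧ Pres T X := by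
  constructor
  · rintro ⟨⟨-, h⟩, hP⟩ X hX
    exact ⟨(subsingleton_ext_iff T X).1 (h X hX), hP ▸ hX⟩
  · intro h
    exact ⟨⟨gen_self T, fun X hX => (subsingleton_ext_iff T X).2 (h X hX).1⟩,
      le_antisymm (pres_le_gen T) fun X hX => (h X hX).2⟩

end General

/-! ### Finite generation under a change of scalars -/

/-- Finite generation passes along an additive map that carries each scalar of `R` to some scalar
of `S`: the image is contained in a finitely generated submodule. -/
theorem exists_finset_span {R S M N : Type*} [Ring R] [Ring S] [AddCommGroup M] [AddCommGroup N]
    [Module R M] [Module S N] [Module.Finite R M] (f : M →+ N)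
    (hf : ∀ a : R, ∃ b : S, ∀ m, f (a • m) = b • f m) :
    ∃ s : Finset N, ∀ m, f m ∈ Submodule.span S (s : Set N) := by
  classical
  obtain ⟨t, ht⟩ := Module.Finite.fg_top (R := R) (M := M)
  refine ⟨t.image f, fun m => ?_⟩
  have hm : m ∈ Submodule.span R (t : Set M) := ht ▸ Submodule.mem_top
  induction hm using Submodule.span_induction with
  | mem x hx => exact Submodule.subset_span (by simpa using ⟨x, hx, rfl⟩)
  | zero => rw [map_zero]; exact zero_mem _
  | add x y _ _ hx hy => rw [map_add]; exact add_mem hx hy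
  | smul a x _ hx =>
    obtain ⟨b, hb⟩ := hf a
    rw [hb]
    exact Submodule.smul_mem _ _ hx

end QuasiTilting

namespace OnePointExt

open QuasiTilting

section Functors

variable {k B P₀ : Type u} [Field k] [Ring B] [Algebra k B] [AddCommGroup P₀] [Module k P₀]
  [Module B P₀] [IsScalarTower k B P₀]
  {X Y Z : Type u} [AddCommGroup X] [Module (OnePointExt k B P₀) X]
  [AddCommGroup Y] [Module (OnePointExt k B P₀) Y]
  [AddCommGroup Z] [Module (OnePointExt k B P₀) Z]
  {M N L : Type u} [AddCommGroup M] [Module B M] [AddCommGroup N] [Module B N]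
  [AddCommGroup L] [Module B L]

/-! ### The restriction functor -/

lemma eB_mem_AeB : eB k B P₀ ∈ AeB k B P₀ := ⟨1, one_smul _ _⟩

lemma eB_mem_eBA : eB k B P₀ ∈ eBA k B P₀ := ⟨1, mul_one _⟩

/-- Evaluation at `e_B`: the identification of `Hom_A(A e_B, X)` with `e_B X`. -/
def Restr.val : Restr k B P₀ X →+ X where
  toFun f := (show AeB k B P₀ →ₗ[OnePointExt k B P₀] X from f) ⟨eB k B P₀, eB_mem_AeB⟩
  map_zero' := rfl
  map_add' _ _ := rfl

/-- The map `A e_B → X`, `a ↦ a x`, attached to `x ∈ X`; its value at `e_B` is `e_B x`. -/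
def Restr.mk : X →+ Restr k B P₀ X where
  toFun x := (LinearMap.toSpanSingleton (OnePointExt k B P₀) X x).comp (AeB k B P₀).subtype
  map_zero' := LinearMap.ext fun _ => smul_zero _
  map_add' _ _ := LinearMap.ext fun _ => smul_add _ _ _

lemma Restr.val_injective : Function.Injective (Restr.val : Restr k B P₀ X →+ X) := by
  intro f g h
  refine LinearMap.ext fun a => ?_
  have ha : a = a.1 • (⟨eB k B P₀, eB_mem_AeB⟩ : AeB k B P₀) :=
    Subtype.ext (mul_eB_of_mem a.2).symm
  rw [ha]
  exact (LinearMap.map_smul _ _ _).trans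
    ((congrArg (a.1 • ·) h).trans (LinearMap.map_smul _ _ _).symm)

lemma Restr.val_mk (x : X) : (Restr.mk x : Restr k B P₀ X).val = eB k B P₀ • x := rfl

lemma Restr.eB_smul_val (f : Restr k B P₀ X) : eB k B P₀ • f.val = f.val := by
  change eB k B P₀ • (show AeB k B P₀ →ₗ[OnePointExt k B P₀] X from f) _ =
    (show AeB k B P₀ →ₗ[OnePointExt k B P₀] X from f) _
  rw [← LinearMap.map_smul]
  congr 1
  exact Subtype.ext (mul_eB_of_mem eB_mem_AeB)

lemma Restr.mk_val (f : Restr k B P₀ X) : Restr.mk f.val = f :=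
  Restr.val_injective (by rw [val_mk, eB_smul_val])

lemma Restr.mk_surjective : Function.Surjective (Restr.mk : X →+ Restr k B P₀ X) :=
  fun f => ⟨f.val, f.mk_val⟩

lemma Restr.val_smul (b : B) (f : Restr k B P₀ X) : (b • f).val = incl k B P₀ b • f.val := by
  change (show AeB k B P₀ →ₗ[OnePointExt k B P₀] X from f) _ =
    incl k B P₀ b • (show AeB k B P₀ →ₗ[OnePointExt k B P₀] X from f) _
  rw [← LinearMap.map_smul]
  congr 1
  refine Subtype.ext ?_
  change eB k B P₀ * incl k B P₀ b = incl k B P₀ b * eB k B P₀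
  ext <;> simp [eB]

lemma Restr.mk_incl_smul (b : B) (x : X) :
    (Restr.mk (incl k B P₀ b • x) : Restr k B P₀ X) = b • Restr.mk x :=
  Restr.val_injective (by
    rw [val_smul, val_mk, val_mk, smul_smul, smul_smul]
    congr 1
    ext <;> simp [eB])

/-- The restriction functor on maps. -/
def Restr.map (g : X →ₗ[OnePointExt k B P₀] Y) : Restr k B P₀ X →ₗ[B] Restr k B P₀ Y where
  toFun f := LinearMap.comp g f
  map_add' _ _ := LinearMap.comp_add _ _ _
  map_smul' _ _ := rfl

lemma Restr.val_map (g : X →ₗ[OnePointExt k B P₀] Y) (f : Restr k B P₀ X) :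
    (Restr.map g f).val = g f.val := rfl

lemma Restr.map_mk (g : X →ₗ[OnePointExt k B P₀] Y) (x : X) :
    Restr.map g (Restr.mk x) = Restr.mk (g x) :=
  Restr.val_injective (by rw [val_map, val_mk, val_mk, map_smul])

lemma Restr.map_injective {g : X →ₗ[OnePointExt k B P₀] Y} (hg : Function.Injective g) :
    Function.Injective (Restr.map g) :=
  fun _ _ h => val_injective (hg (congrArg Restr.val h))

lemma Restr.map_surjective {g : X →ₗ[OnePointExt k B P₀] Y} (hg : Function.Surjective g) :
    Function.Surjective (Restr.map g) := by
  intro f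
  obtain ⟨x, hx⟩ := hg f.val
  exact ⟨Restr.mk x, by rw [map_mk, hx, mk_val]⟩

lemma Restr.map_exact {g : X →ₗ[OnePointExt k B P₀] Y} {h : Y →ₗ[OnePointExt k B P₀] Z}
    (hgh : Function.Exact g h) : Function.Exact (Restr.map g) (Restr.map h) := by
  intro y
  constructor
  · intro hy
    obtain ⟨x, hx⟩ := (hgh y.val).1 (congrArg Restr.val hy)
    exact ⟨Restr.mk x, by rw [map_mk, hx, mk_val]⟩
  · rintro ⟨x, rfl⟩
    exact Restr.val_injective (hgh.apply_apply_eq_zero x.val)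

/-- Restriction commutes with direct sums. -/
noncomputable def Restr.finsupp (I : Type u) :
    Restr k B P₀ (I →₀ X) ≃ₗ[B] (I →₀ Restr k B P₀ X) where
  toFun f := Finsupp.mapRange.addMonoidHom Restr.mk f.val
  invFun f := Restr.mk (Finsupp.mapRange.addMonoidHom Restr.val f)
  map_add' f g := by rw [map_add, map_add]
  map_smul' b f := by
    ext1 i
    simp [Restr.val_smul, Restr.mk_incl_smul]
  left_inv f := Restr.val_injective (by
    ext1 i
    rw [Restr.val_mk]
    simp only [Finsupp.smul_apply, Finsupp.mapRange.addMonoidHom_apply, Finsupp.mapRange_apply,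
      Restr.val_mk]
    rw [← Finsupp.smul_apply, ← Finsupp.smul_apply, Restr.eB_smul_val, Restr.eB_smul_val])
  right_inv f := by
    ext1 i
    simp [Restr.val_mk, Restr.eB_smul_val, Restr.mk_val]

lemma Restr.finsupp_mk (I : Type u) (v : I →₀ X) (j : I) :
    Restr.finsupp I (Restr.mk v : Restr k B P₀ (I →₀ X)) j = Restr.mk (v j) := by
  change Restr.mk (eB k B P₀ • v j) = _
  rw [← incl_one, mk_incl_smul, one_smul]

lemma Restr.addOf {T X : ModuleCat.{u} (OnePointExt k B P₀)} (h : AddOf T X) :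
    AddOf (ModuleCat.of B (Restr k B P₀ T)) (ModuleCat.of B (Restr k B P₀ X)) := by
  obtain ⟨I, i, p, hpi⟩ := h
  refine ⟨I, (Restr.finsupp I).toLinearMap ∘ₗ Restr.map i,
    Restr.map p ∘ₗ (Restr.finsupp I).symm.toLinearMap, LinearMap.ext fun x => ?_⟩
  simp only [LinearMap.comp_apply, LinearEquiv.coe_coe, LinearEquiv.symm_apply_apply]
  exact Restr.val_injective (LinearMap.congr_fun hpi x.val)

/-! ### The extension functor and the adjunction -/

/-- An element of `ℰ M`, viewed as the `B`-linear map `e_B A → M` that it is. -/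
def Exten.toHom : Exten k B P₀ M ≃+ (eBA k B P₀ →ₗ[B] M) := AddEquiv.refl _

lemma Exten.ext {f g : Exten k B P₀ M} (h : ∀ q, f.toHom q = g.toHom q) : f = g :=
  LinearMap.ext h

lemma Exten.toHom_smul (a : OnePointExt k B P₀) (f : Exten k B P₀ M) (q : eBA k B P₀) :
    (a • f).toHom q = f.toHom (rightMulEBA a q) := rfl

/-- The extension functor on maps. -/
def Exten.map (g : M →ₗ[B] N) : Exten k B P₀ M →ₗ[OnePointExt k B P₀] Exten k B P₀ N where
  toFun f := LinearMap.comp g f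
  map_add' _ _ := LinearMap.comp_add _ _ _
  map_smul' _ _ := rfl

lemma Exten.toHom_map (g : M →ₗ[B] N) (f : Exten k B P₀ M) (q : eBA k B P₀) :
    (Exten.map g f).toHom q = g (f.toHom q) := rfl

/-- The generator `e_B` of the direct summand `B = e_B A e_B` of `e_B A`. -/
def one : eBA k B P₀ := ⟨eB k B P₀, eB_mem_eBA⟩

/-- The counit `ℛℰ M ≅ M` on underlying elements: `f ↦ f(e_B)`. -/
def Exten.eval : Exten k B P₀ M →+ M where
  toFun f := f.toHom one
  map_zero' := rfl
  map_add' _ _ := rfl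

lemma rightMulEBA_eB (q : eBA k B P₀) : rightMulEBA (eB k B P₀) q = q.1.b • one := by
  refine Subtype.ext ?_
  change q.1 * eB k B P₀ = incl k B P₀ q.1.b * eB k B P₀
  ext <;> simp [eB]

lemma rightMulEBA_one (q : eBA k B P₀) : rightMulEBA q.1 one = q :=
  Subtype.ext (eB_mul_of_mem q.2)

lemma rightMulEBA_incl_one (b : B) :
    rightMulEBA (incl k B P₀ b) one = b • (one : eBA k B P₀) := by
  refine Subtype.ext ?_
  change eB k B P₀ * incl k B P₀ b = incl k B P₀ b * eB k B P₀
  ext <;> simp [eB]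

lemma Exten.toHom_eB_smul (f : Exten k B P₀ M) (q : eBA k B P₀) :
    (eB k B P₀ • f).toHom q = q.1.b • f.eval := by
  rw [toHom_smul, rightMulEBA_eB, map_smul]
  rfl

/-- The adjunct `X → ℰ N` of a map `ℛ X → N`. -/
def Exten.lift (h : Restr k B P₀ X →ₗ[B] N) : X →ₗ[OnePointExt k B P₀] Exten k B P₀ N where
  toFun x := Exten.toHom.symm
    { toFun := fun q => h (Restr.mk (q.1 • x))
      map_add' := fun q q' => by
        rw [AddSubgroup.coe_add, add_smul, map_add, map_add]
      map_smul' := fun b q => by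
        change h (Restr.mk ((incl k B P₀ b * q.1) • x)) = _
        rw [mul_smul, Restr.mk_incl_smul, map_smul]
        rfl }
  map_add' x y := Exten.ext fun q => by
    change h (Restr.mk (q.1 • (x + y))) = h (Restr.mk (q.1 • x)) + h (Restr.mk (q.1 • y))
    rw [smul_add, map_add, map_add]
  map_smul' a x := Exten.ext fun q => by
    change h (Restr.mk (q.1 • a • x)) = h (Restr.mk ((q.1 * a) • x))
    rw [mul_smul]

lemma Exten.toHom_lift (h : Restr k B P₀ X →ₗ[B] N) (x : X) (q : eBA k B P₀) :
    (Exten.lift h x).toHom q = h (Restr.mk (q.1 • x)) := rfl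

lemma Exten.eval_lift (h : Restr k B P₀ X →ₗ[B] N) (r : Restr k B P₀ X) :
    (Exten.lift h r.val).eval = h r := by
  change h (Restr.mk (eB k B P₀ • r.val)) = h r
  rw [Restr.eB_smul_val, Restr.mk_val]

/-- The adjunct `ℛ X → N` of a map `X → ℰ N`. -/
def Exten.unlift (l : X →ₗ[OnePointExt k B P₀] Exten k B P₀ N) : Restr k B P₀ X →ₗ[B] N where
  toFun r := (l r.val).eval
  map_add' r s := by rw [map_add, map_add, map_add]
  map_smul' b r := by
    rw [Restr.val_smul, map_smul]
    change (l r.val).toHom (rightMulEBA (incl k B P₀ b) one) = b • (l r.val).toHom one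
    rw [rightMulEBA_incl_one, map_smul]

lemma Exten.unlift_apply (l : X →ₗ[OnePointExt k B P₀] Exten k B P₀ N) (r : Restr k B P₀ X) :
    Exten.unlift l r = (l r.val).eval := rfl

/-- An injective map into `ℰ N` has an injective adjunct. -/
lemma Exten.unlift_injective {l : X →ₗ[OnePointExt k B P₀] Exten k B P₀ N}
    (hl : Function.Injective l) : Function.Injective (Exten.unlift l) := by
  rw [injective_iff_map_eq_zero]
  intro r hr
  refine Restr.val_injective (hl ?_)
  rw [map_zero, map_zero, ← Restr.eB_smul_val, map_smul]
  refine Exten.ext fun q => ?_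
  rw [toHom_eB_smul, ← unlift_apply, hr, smul_zero]
  rfl

/-- The counit `ℛℰ N → N`, an isomorphism. -/
def Exten.counit : Restr k B P₀ (Exten k B P₀ N) →ₗ[B] N := Exten.unlift LinearMap.id

lemma Exten.counit_apply (r : Restr k B P₀ (Exten k B P₀ N)) :
    Exten.counit r = r.val.eval := rfl

lemma Exten.counit_injective :
    Function.Injective (Exten.counit : Restr k B P₀ (Exten k B P₀ N) →ₗ[B] N) :=
  Exten.unlift_injective Function.injective_id

lemma Exten.counit_surjective :
    Function.Surjective (Exten.counit : Restr k B P₀ (Exten k B P₀ N) →ₗ[B] N) := by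
  intro n
  let f : Exten k B P₀ N := Exten.toHom.symm
    { toFun := fun q => q.1.b • n
      map_add' := fun q q' => by rw [AddSubgroup.coe_add, add_b, add_smul]
      map_smul' := fun b q => by
        change (incl k B P₀ b * q.1).b • n = _
        rw [mul_b, incl_b, mul_smul]
        rfl }
  refine ⟨Restr.mk f, ?_⟩
  rw [counit_apply, Restr.val_mk]
  change (eB k B P₀ • f).toHom one = n
  rw [toHom_eB_smul]
  change (1 : B) • (1 : B) • n = n
  rw [one_smul, one_smul]

variable (X) in
/-- The unit `X → ℰℛ X` of the adjunction. -/
def unit : X →ₗ[OnePointExt k B P₀] Exten k B P₀ (Restr k B P₀ X) := Exten.lift LinearMap.id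

lemma toHom_unit (x : X) (q : eBA k B P₀) :
    Exten.toHom (unit X x) q = Restr.mk (q.1 • x) := rfl

lemma unit_naturality (g : X →ₗ[OnePointExt k B P₀] Y) (x : X) :
    unit Y (g x) = Exten.map (Restr.map g) (unit X x) := by
  refine Exten.ext fun q => ?_
  rw [toHom_unit, Exten.toHom_map, toHom_unit, Restr.map_mk, g.map_smul]

lemma eB_smul_of_unit_eq_zero {x : X}
    (hx : (unit X x : Exten k B P₀ (Restr k B P₀ X)) = 0) : eB k B P₀ • x = 0 := by
  have h : (Restr.mk (eB k B P₀ • x) : Restr k B P₀ X) = 0 :=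
    congrArg (fun f => Exten.toHom f one) hx
  have h2 := congrArg Restr.val h
  rw [Restr.val_mk, smul_smul, map_zero] at h2
  rwa [mul_eB_of_mem eB_mem_AeB] at h2

/-! ### Exactness of the extension functor -/

variable (k B P₀) in
/-- The components of `e_B A`: as a `B`-module it is `B ⊕ P₀`. -/
def eBAEquiv : eBA k B P₀ ≃ₗ[B] B × P₀ where
  toFun q := (q.1.b, q.1.p)
  invFun x := ⟨⟨x.1, x.2, 0⟩, ⟨⟨x.1, x.2, 0⟩, by ext <;> simp [eB]⟩⟩
  map_add' _ _ := rfl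
  map_smul' b q := by
    change ((incl k B P₀ b * q.1).b, (incl k B P₀ b * q.1).p) = (b • q.1.b, b • q.1.p)
    simp
  left_inv q := by
    refine Subtype.ext ?_
    have hc : q.1.c = 0 := by
      rw [← eB_mul_of_mem q.2]
      simp [eB]
    ext
    · rfl
    · rfl
    · exact hc.symm
  right_inv _ := rfl

instance [Module.Finite B P₀] : Module.Finite B (eBA k B P₀) :=
  Module.Finite.equiv (eBAEquiv k B P₀).symm

instance [Module.Projective B P₀] : Module.Projective B (eBA k B P₀) :=
  Module.Projective.of_equiv (eBAEquiv k B P₀).symm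

lemma Exten.map_injective {g : M →ₗ[B] N} (hg : Function.Injective g) :
    Function.Injective (Exten.map g : Exten k B P₀ M →ₗ[OnePointExt k B P₀] Exten k B P₀ N) :=
  fun _ _ h => Exten.ext fun q => hg (congrArg (fun f => Exten.toHom f q) h)

lemma Exten.map_surjective [Module.Projective B P₀] {g : M →ₗ[B] N}
    (hg : Function.Surjective g) :
    Function.Surjective (Exten.map g : Exten k B P₀ M →ₗ[OnePointExt k B P₀] Exten k B P₀ N) := by
  intro f
  obtain ⟨l, hl⟩ := Module.projective_lifting_property g f.toHom hg
  exact ⟨Exten.toHom.symm l, Exten.ext fun q => LinearMap.congr_fun hl q⟩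

lemma Exten.map_exact [Module.Projective B P₀] {g : M →ₗ[B] N} {h : N →ₗ[B] L}
    (hgh : Function.Exact g h) :
    Function.Exact (Exten.map g : Exten k B P₀ M →ₗ[OnePointExt k B P₀] Exten k B P₀ N)
      (Exten.map h) := by
  intro f
  constructor
  · intro hf
    have hr (q : eBA k B P₀) : f.toHom q ∈ LinearMap.range g :=
      (hgh _).1 (congrArg (fun f => Exten.toHom f q) hf)
    obtain ⟨l, hl⟩ := Module.projective_lifting_property g.rangeRestrict
      (f.toHom.codRestrict _ hr) g.surjective_rangeRestrict
    exact ⟨Exten.toHom.symm l, Exten.ext fun q => congrArg Subtype.val (LinearMap.congr_fun hl q)⟩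
  · rintro ⟨f, rfl⟩
    exact Exten.ext fun q => hgh.apply_apply_eq_zero _

/-- A `B`-linear map from the finitely generated module `e_B A` to a direct sum has components in
finitely many summands only. -/
lemma Exten.eq_sum_single [Module.Finite B P₀] {I : Type u} (f : Exten k B P₀ (I →₀ M)) :
    ∃ s : Finset I, f = ∑ i ∈ s, Exten.map (Finsupp.lsingle i ∘ₗ Finsupp.lapply i) f := by
  classical
  obtain ⟨t, ht⟩ := Module.Finite.fg_top (R := B) (M := eBA k B P₀)
  let s : Finset I := t.biUnion fun q => (f.toHom q).support
  have hs (q : eBA k B P₀) : f.toHom q ∈ Finsupp.supported M B (s : Set I) := by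
    have hle : Submodule.span B (t : Set (eBA k B P₀)) ≤
        (Finsupp.supported M B (s : Set I)).comap f.toHom := by
      refine Submodule.span_le.2 fun q hq => ?_
      change ((f.toHom q).support : Set I) ⊆ s
      exact_mod_cast Finset.subset_biUnion_of_mem (fun q => (f.toHom q).support) hq
    exact hle (ht ▸ Submodule.mem_top)
  refine ⟨s, Exten.ext fun q => ?_⟩
  rw [map_sum, LinearMap.sum_apply]
  change f.toHom q = ∑ i ∈ s, Finsupp.single i (f.toHom q i)
  have h1 : (f.toHom q).support ⊆ s := by
    have := hs q
    rw [Finsupp.mem_supported] at this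
    exact_mod_cast this
  conv_lhs => rw [← Finsupp.sum_single (f.toHom q)]
  exact Finsupp.sum_of_support_subset _ h1 _ fun i _ => Finsupp.single_zero i

/-- Extension commutes with direct sums, as `e_B A` is finitely generated over `B`. -/
noncomputable def Exten.finsupp [Module.Finite B P₀] (I : Type u) :
    (I →₀ Exten k B P₀ M) ≃ₗ[OnePointExt k B P₀] Exten k B P₀ (I →₀ M) :=
  LinearEquiv.ofBijective
    (Finsupp.lsum ℕ fun i => Exten.map (Finsupp.lsingle i)) (by
      classical
      constructor
      · have key (f : I →₀ Exten k B P₀ M) (j : I) : Exten.map (Finsupp.lapply j)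
            (Finsupp.lsum ℕ (fun i => Exten.map (k := k) (P₀ := P₀) (Finsupp.lsingle i)) f)
              = f j := by
          induction f using Finsupp.induction_linear with
          | zero => rw [map_zero, map_zero]; rfl
          | add f g hf hg => rw [map_add, map_add, hf, hg]; rfl
          | single i x =>
            rw [Finsupp.lsum_single]
            refine Exten.ext fun q => ?_
            change Finsupp.single i (x.toHom q) j = (Finsupp.single i x j).toHom q
            by_cases h : i = j
            · subst h; simp
            · simp [h]
        intro f g hfg
        ext1 j
        rw [← key f, ← key g, hfg]
      · intro f
        obtain ⟨s, hs⟩ := f.eq_sum_single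
        refine ⟨∑ i ∈ s, Finsupp.single i (Exten.map (Finsupp.lapply i) f), ?_⟩
        rw [map_sum]
        conv_rhs => rw [hs]
        exact Finset.sum_congr rfl fun i _ => by rw [Finsupp.lsum_single]; rfl)

lemma Exten.addOf [Module.Finite B P₀] {T M : ModuleCat.{u} B} (h : AddOf T M) :
    AddOf (ModuleCat.of (OnePointExt k B P₀) (Exten k B P₀ T))
      (ModuleCat.of (OnePointExt k B P₀) (Exten k B P₀ M)) := by
  obtain ⟨I, i, p, hpi⟩ := h
  refine ⟨I, (Exten.finsupp I).symm.toLinearMap ∘ₗ Exten.map i,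
    Exten.map p ∘ₗ (Exten.finsupp I).toLinearMap, LinearMap.ext fun x => ?_⟩
  simp only [LinearMap.comp_apply, LinearEquiv.coe_coe, LinearEquiv.apply_symm_apply]
  exact Exten.ext fun q => LinearMap.congr_fun hpi _

end Functors

end OnePointExt

namespace OnePointExt

open QuasiTilting

section Killed

variable {k B P₀ : Type u} [Field k] [Ring B] [Algebra k B] [AddCommGroup P₀] [Module k P₀]
  [Module B P₀] [IsScalarTower k B P₀]
  {X Y : Type u} [AddCommGroup X] [Module (OnePointExt k B P₀) X]
  [AddCommGroup Y] [Module (OnePointExt k B P₀) Y]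

/-! ### Modules annihilated by `e_B` -/

variable (k B P₀) in
/-- The structure map `k → A` of the `k`-algebra `A`. -/
def ofK : k →+* OnePointExt k B P₀ where
  toFun c := ⟨algebraMap k B c, 0, c⟩
  map_one' := by ext <;> simp
  map_zero' := by ext <;> simp
  map_mul' c d := by ext <;> simp
  map_add' c d := by ext <;> simp

lemma eK_mul (a : OnePointExt k B P₀) : eK k B P₀ * a = ofK k B P₀ a.c * eK k B P₀ := by
  ext <;> simp [eK, ofK]

/-- On a module annihilated by `e_B`, the ring acts through `A → k`. -/
lemma smul_eq_ofK_smul (hX : ∀ x : X, eB k B P₀ • x = 0) (a : OnePointExt k B P₀) (x : X) :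
    a • x = ofK k B P₀ a.c • x := by
  have h (y : X) : eK k B P₀ • y = y := by
    have h1 : (1 : OnePointExt k B P₀) = eB k B P₀ + eK k B P₀ := by ext <;> simp [eB, eK]
    conv_rhs => rw [← one_smul (OnePointExt k B P₀) y, h1, add_smul, hX, zero_add]
  rw [← h (a • x), smul_smul, eK_mul, mul_smul, h]

/-- Modules annihilated by `e_B` are injective: a `k`-linear retraction `l` gives the `A`-linear
retraction `z ↦ l (e z)`, where `e = 1 - e_B`. -/
lemma exists_retraction (hX : ∀ x : X, eB k B P₀ • x = 0) (i : X →ₗ[OnePointExt k B P₀] Y)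
    (hi : Function.Injective i) : ∃ l : Y →ₗ[OnePointExt k B P₀] X, l ∘ₗ i = LinearMap.id := by
  let _ : Module k X := Module.compHom X (ofK k B P₀)
  let _ : Module k Y := Module.compHom Y (ofK k B P₀)
  let i₀ : X →ₗ[k] Y :=
    { toFun := i
      map_add' := i.map_add
      map_smul' := fun c x => i.map_smul (ofK k B P₀ c) x }
  obtain ⟨l₀, hl₀⟩ := i₀.exists_leftInverse_of_injective (LinearMap.ker_eq_bot.2 hi)
  have hsmul (c : k) (y : Y) : l₀ (ofK k B P₀ c • y) = ofK k B P₀ c • l₀ y := l₀.map_smul c y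
  refine ⟨{ toFun := fun y => l₀ (eK k B P₀ • y)
            map_add' := fun y z => by rw [smul_add, map_add]
            map_smul' := fun a y => ?_ }, LinearMap.ext fun x => ?_⟩
  · rw [smul_smul, eK_mul, mul_smul, hsmul]
    exact (smul_eq_ofK_smul hX a _).symm
  · change l₀ (eK k B P₀ • i x) = x
    rw [← i.map_smul, smul_eq_ofK_smul hX]
    have h1 : ofK k B P₀ (eK k B P₀).c = 1 := (ofK k B P₀).map_one
    rw [h1, one_smul]
    exact LinearMap.congr_fun hl₀ x

lemma extVanishes_of_eB_smul_eq_zero (T : Type u) [AddCommGroup T]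
    [Module (OnePointExt k B P₀) T] (hX : ∀ x : X, eB k B P₀ • x = 0) :
    ExtVanishes (OnePointExt k B P₀) T X := by
  intro Z W _ _ _ _ i g hi hg h hh
  have hr : Function.Exact i g.rangeRestrict := fun z => Subtype.ext_iff.trans (hg z)
  obtain ⟨-, s, hs⟩ := ((Function.Exact.split_tfae' hr).out 1 0 rfl rfl).1
    ⟨g.surjective_rangeRestrict, exists_retraction hX i hi⟩
  refine ⟨s ∘ₗ h.codRestrict _ hh, LinearMap.ext fun t => ?_⟩
  exact congrArg Subtype.val (LinearMap.congr_fun hs ⟨h t, hh t⟩)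

/-- A module annihilated by `e_B` is a vector space over `k`, hence a direct sum of copies
of `S`. -/
lemma addOf_simpleS (X : ModuleCat.{u} (OnePointExt k B P₀))
    (hX : ∀ x : X, eB k B P₀ • x = 0) : AddOf (simpleS k B P₀) X := by
  let _ : Module k X := Module.compHom X (ofK k B P₀)
  let b := Module.Basis.ofVectorSpace k X
  refine ⟨Module.Basis.ofVectorSpaceIndex k X,
    { toFun := fun x => b.repr x
      map_add' := fun x y => b.repr.map_add x y
      map_smul' := fun a x => ?_ },
    { toFun := fun v => b.repr.symm v
      map_add' := fun v w => b.repr.symm.map_add v w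
      map_smul' := fun a v => ?_ }, LinearMap.ext fun x => b.repr.symm_apply_apply x⟩
  · rw [smul_eq_ofK_smul hX]
    exact b.repr.map_smul a.c x
  · refine (b.repr.symm.map_smul a.c v).trans ?_
    exact (smul_eq_ofK_smul hX a _).symm

/-! ### Comparison of `Ext¹` over `A` and over `B` -/

/-- If `Ext¹_A(T, ℰ N) = 0` then `Ext¹_B(ℛ T, N) = 0`: apply the exact functor `ℰ` to a lifting
problem over `B`, and pass to adjuncts. -/
lemma extVanishes_restr [Module.Projective B P₀] {T N : Type u} [AddCommGroup T]
    [Module (OnePointExt k B P₀) T] [AddCommGroup N] [Module B N]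
    (h : ExtVanishes (OnePointExt k B P₀) T (Exten k B P₀ N)) :
    ExtVanishes B (Restr k B P₀ T) N := by
  intro Z W _ _ _ _ i g hi hg f hf
  have hlift (t : T) : Exten.lift f t ∈ LinearMap.range
      (Exten.map g : Exten k B P₀ Z →ₗ[OnePointExt k B P₀] Exten k B P₀ W) := by
    obtain ⟨l, hl⟩ := Module.projective_lifting_property g.rangeRestrict
      ((Exten.toHom (Exten.lift f t)).codRestrict _ fun q => hf _) g.surjective_rangeRestrict
    exact ⟨Exten.toHom.symm l, Exten.ext fun q => congrArg Subtype.val (LinearMap.congr_fun hl q)⟩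
  obtain ⟨l, hl⟩ := h _ _ (Exten.map i) (Exten.map g) (Exten.map_injective hi)
    (Exten.map_exact hg) (Exten.lift f) hlift
  refine ⟨Exten.unlift l, LinearMap.ext fun r => ?_⟩
  rw [← Exten.eval_lift f r, ← hl]
  rfl

/-- If the unit `X → ℰℛ X` is surjective, then `Ext¹_B(ℛ T, ℛ X) = 0` implies
`Ext¹_A(T, X) = 0`. -/
lemma extVanishes_of_restr [Module.Projective B P₀] {T : Type u} [AddCommGroup T]
    [Module (OnePointExt k B P₀) T]
    (hX : Function.Surjective (unit X : X →ₗ[OnePointExt k B P₀] Exten k B P₀ (Restr k B P₀ X)))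
    (h : ExtVanishes B (Restr k B P₀ T) (Restr k B P₀ X)) :
    ExtVanishes (OnePointExt k B P₀) T X := by
  intro Z W _ _ _ _ i g hi hg f hf
  obtain ⟨l, hl⟩ := h _ _ (Restr.map i) (Restr.map g) (Restr.map_injective hi)
    (Restr.map_exact hg) (Restr.map f) fun r => by
      obtain ⟨z, hz⟩ := hf r.val
      exact ⟨Restr.mk z, by rw [Restr.map_mk, hz, ← Restr.val_map, Restr.mk_val]⟩
  -- The kernel of `Z → W × ℰℛ Z` is the kernel `K` of the unit of `X`, which is annihilated by
  -- `e_B`, so that maps into its image lift to `Z`. The pair of `f` and the adjunct of `l` is such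
  -- a map: it agrees with `(g z, unit z)`, where `g z = f t`, up to an element of `ℰℛ X`, and that
  -- comes from `X` as the unit of `X` is surjective.
  let K := LinearMap.ker (unit X : X →ₗ[OnePointExt k B P₀] Exten k B P₀ (Restr k B P₀ X))
  have hK : ∀ x : K, eB k B P₀ • x = 0 := fun x => Subtype.ext (eB_smul_of_unit_eq_zero x.2)
  let θ : Z →ₗ[OnePointExt k B P₀] W × Exten k B P₀ (Restr k B P₀ Z) := g.prod (unit Z)
  have hθ : Function.Exact (i ∘ₗ K.subtype) θ := by
    intro z
    constructor
    · intro hz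
      obtain ⟨x, rfl⟩ := (hg z).1 (congrArg Prod.fst hz)
      have h2 : unit Z (i x) = 0 := congrArg Prod.snd hz
      rw [unit_naturality] at h2
      have h3 : unit X x = 0 := Exten.map_injective (Restr.map_injective hi) (by
        rw [h2, map_zero])
      exact ⟨⟨x, h3⟩, rfl⟩
    · rintro ⟨x, rfl⟩
      refine Prod.ext (hg.apply_apply_eq_zero x.1) ?_
      change unit Z (i x) = 0
      rw [unit_naturality, show unit X x.1 = 0 from x.2, map_zero]
  obtain ⟨m, hm⟩ := extVanishes_of_eB_smul_eq_zero T hK Z _ (i ∘ₗ K.subtype) θ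
    (hi.comp K.injective_subtype) hθ (f.prod (Exten.lift l)) (fun t => by
      obtain ⟨z, hz⟩ := hf t
      have h1 : Exten.map (Restr.map g) (Exten.lift l t - unit Z z) = 0 := by
        rw [map_sub, ← unit_naturality, hz, sub_eq_zero]
        refine Exten.ext fun q => ?_
        rw [Exten.toHom_map, Exten.toHom_lift, toHom_unit, ← f.map_smul, ← Restr.map_mk, ← hl]
        rfl
      obtain ⟨y, hy⟩ := (Exten.map_exact (Restr.map_exact hg) _).1 h1
      obtain ⟨x, rfl⟩ := hX y
      refine ⟨z + i x, Prod.ext ?_ ?_⟩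
      · change g (z + i x) = f t
        rw [map_add, hg.apply_apply_eq_zero, add_zero, hz]
      · change unit Z (z + i x) = Exten.lift l t
        rw [map_add, unit_naturality, hy, add_sub_cancel])
  refine ⟨m, LinearMap.ext fun t => ?_⟩
  exact congrArg Prod.fst (LinearMap.congr_fun hm t)

end Killed

end OnePointExt

namespace OnePointExt

open QuasiTilting

section Transfer

variable {k B P₀ : Type u} [Field k] [Ring B] [Algebra k B] [AddCommGroup P₀] [Module k P₀]
  [Module B P₀] [IsScalarTower k B P₀]

/-! ### Restriction of finendo quasi-tilting modules -/

lemma isFinendo_restr {T : ModuleCat.{u} (OnePointExt k B P₀)} (hT : IsFinendo T) :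
    IsFinendo ((restriction k B P₀).obj T) := by
  have : Module.Finite (Module.End (OnePointExt k B P₀) T) T := hT
  obtain ⟨s, hs⟩ := exists_finset_span (R := Module.End (OnePointExt k B P₀) T)
    (S := Module.End B (Restr k B P₀ T)) (Restr.mk : T →+ Restr k B P₀ T)
    fun a => ⟨Restr.map a, fun m => (Restr.map_mk a m).symm⟩
  refine ⟨s, eq_top_iff.2 fun r _ => ?_⟩
  obtain ⟨m, rfl⟩ := Restr.mk_surjective r
  exact hs m

/-- Every module in `Gen (ℛ T)` is the restriction of a module in `Gen T`, namely of the image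
`X` of the adjunct `T^(I) → ℰ Y` of an epimorphism `ℛ T^(I) → Y`; moreover `ℰ Y / X` is
annihilated by `e_B`. -/
lemma exists_submodule_exten {T : ModuleCat.{u} (OnePointExt k B P₀)} {Y : ModuleCat.{u} B}
    (hY : Gen (ModuleCat.of B (Restr k B P₀ T)) Y) :
    ∃ X : Submodule (OnePointExt k B P₀) (Exten k B P₀ Y),
      Gen T (ModuleCat.of (OnePointExt k B P₀) X) ∧
      Nonempty (Restr k B P₀ X ≃ₗ[B] Y) ∧
      ∀ z : Exten k B P₀ Y ⧸ X, eB k B P₀ • z = 0 := by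
  obtain ⟨I, p, hp⟩ := gen_iff.1 hY
  let h : Restr k B P₀ (I →₀ T) →ₗ[B] Y := p ∘ₗ (Restr.finsupp I).toLinearMap
  have hh : Function.Surjective h := hp.comp (Restr.finsupp I).surjective
  refine ⟨LinearMap.range (Exten.lift h),
    gen_iff.2 ⟨I, (Exten.lift h).rangeRestrict, LinearMap.surjective_rangeRestrict _⟩,
    ⟨LinearEquiv.ofBijective (Exten.unlift (Submodule.subtype _))
      ⟨Exten.unlift_injective (Submodule.injective_subtype _), fun y => ?_⟩⟩, fun z => ?_⟩
  · obtain ⟨r, rfl⟩ := hh y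
    refine ⟨Restr.map (Exten.lift h).rangeRestrict r, ?_⟩
    rw [← Exten.eval_lift h r]
    rfl
  · obtain ⟨f, rfl⟩ := Submodule.mkQ_surjective _ z
    obtain ⟨r, hr⟩ := hh f.eval
    rw [← map_smul, Submodule.mkQ_apply, Submodule.Quotient.mk_eq_zero]
    refine ⟨r.val, ?_⟩
    rw [← Restr.eB_smul_val, map_smul]
    refine Exten.ext fun q => ?_
    rw [Exten.toHom_eB_smul, Exten.toHom_eB_smul, Exten.eval_lift, hr]

lemma isQuasiTilting_restr [Module.Projective B P₀] {T : ModuleCat.{u} (OnePointExt k B P₀)}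
    (hT : IsQuasiTilting T) : IsQuasiTilting ((restriction k B P₀).obj T) := by
  rw [isQuasiTilting_iff] at hT ⊢
  intro Y hY
  obtain ⟨X, hX, ⟨e⟩, hq⟩ := exists_submodule_exten hY
  obtain ⟨hext, M₁, M₀, f, g, h₁, h₀, hfg, hg⟩ := hT _ hX
  refine ⟨extVanishes_restr (hext.of_submodule X (extVanishes_of_eB_smul_eq_zero T hq)),
    ModuleCat.of B (Restr k B P₀ M₁), ModuleCat.of B (Restr k B P₀ M₀), Restr.map f,
    e.toLinearMap ∘ₗ Restr.map g, Restr.addOf h₁, Restr.addOf h₀, fun m => ?_,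
    e.surjective.comp (Restr.map_surjective hg)⟩
  exact e.map_eq_zero_iff.trans (Restr.map_exact hfg m)

/-! ### Modules with surjective unit -/

section Unit

variable {X Y : Type u} [AddCommGroup X] [Module (OnePointExt k B P₀) X]
  [AddCommGroup Y] [Module (OnePointExt k B P₀) Y]

lemma unit_surjective_of_surjective [Module.Projective B P₀] (g : X →ₗ[OnePointExt k B P₀] Y)
    (hg : Function.Surjective g)
    (hX : Function.Surjective (unit X : X →ₗ[OnePointExt k B P₀] Exten k B P₀ (Restr k B P₀ X))) :
    Function.Surjective (unit Y : Y →ₗ[OnePointExt k B P₀] Exten k B P₀ (Restr k B P₀ Y)) := by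
  intro f
  obtain ⟨f, rfl⟩ := Exten.map_surjective (Restr.map_surjective hg) f
  obtain ⟨x, rfl⟩ := hX f
  exact ⟨g x, unit_naturality g x⟩

lemma unit_surjective_finsupp [Module.Finite B P₀] (I : Type u)
    (hX : Function.Surjective (unit X : X →ₗ[OnePointExt k B P₀] Exten k B P₀ (Restr k B P₀ X))) :
    Function.Surjective (unit (I →₀ X) :
      (I →₀ X) →ₗ[OnePointExt k B P₀] Exten k B P₀ (Restr k B P₀ (I →₀ X))) := by
  intro f
  obtain ⟨v, hv⟩ := (Exten.finsupp I).surjective (Exten.map (Restr.finsupp I).toLinearMap f)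
  have hf : f = Exten.map (Restr.finsupp I).symm.toLinearMap (Exten.finsupp I v) := by
    rw [hv]
    exact Exten.ext fun q => ((Restr.finsupp I).symm_apply_apply _).symm
  rw [hf, ← LinearMap.mem_range]
  clear hf hv f
  induction v using Finsupp.induction_linear with
  | zero => rw [map_zero, map_zero]; exact zero_mem _
  | add v w hv hw => rw [map_add, map_add]; exact add_mem hv hw
  | single i y =>
    obtain ⟨x, rfl⟩ := hX y
    refine ⟨Finsupp.single i x, ?_⟩
    change unit _ ((Finsupp.lsingle i : X →ₗ[OnePointExt k B P₀] (I →₀ X)) x) = _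
    rw [unit_naturality]
    have h1 (y : Exten k B P₀ (Restr k B P₀ X)) : Exten.finsupp I (Finsupp.single i y) =
        Exten.map (Finsupp.lsingle i) y := by
      classical
      change Finsupp.lsum ℕ _ (Finsupp.single i y) = _
      rw [Finsupp.lsum_single]
    rw [h1]
    refine Exten.ext fun q => ?_
    simp only [Exten.toHom_map, LinearEquiv.coe_coe]
    rw [LinearEquiv.eq_symm_apply, toHom_unit, Restr.map_mk]
    ext1 j
    rw [Restr.finsupp_mk]
    classical
    by_cases h : i = j
    · subst h
      simp
    · simp [h]

end Unit

/-- A module in `Gen T` has surjective unit `X → ℰℛ X` if `T` has. -/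
lemma unit_surjective_of_gen [Module.Finite B P₀] [Module.Projective B P₀]
    {T X : ModuleCat.{u} (OnePointExt k B P₀)} (hX : Gen T X)
    (hT : Function.Surjective (unit T : T →ₗ[OnePointExt k B P₀] Exten k B P₀ (Restr k B P₀ T))) :
    Function.Surjective (unit X : X →ₗ[OnePointExt k B P₀] Exten k B P₀ (Restr k B P₀ X)) := by
  obtain ⟨I, f, hf⟩ := gen_iff.1 hX
  exact unit_surjective_of_surjective f hf (unit_surjective_finsupp I hT)

/-! ### Extension of finendo quasi-tilting modules -/

variable (k P₀) in
/-- The restriction of `ℰ T' ⊕ S` is `T'`, as `ℛ S = 0` and `ℛℰ T' ≅ T'`. -/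
noncomputable def restrExtenProdEquiv (T' : Type u) [AddCommGroup T'] [Module B T'] :
    Restr k B P₀ (Exten k B P₀ T' × simpleS k B P₀) ≃ₗ[B] T' :=
  LinearEquiv.ofBijective (Exten.counit ∘ₗ Restr.map (LinearMap.fst _ _ _)) (by
    constructor
    · rw [injective_iff_map_eq_zero]
      intro r hr
      have h1 : Restr.map (LinearMap.fst _ _ _) r = 0 :=
        Exten.counit_injective (hr.trans (map_zero _).symm)
      refine Restr.val_injective (Prod.ext (congrArg Restr.val h1) ?_)
      rw [← Restr.eB_smul_val]
      exact zero_mul (M₀ := k) r.val.2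
    · exact Exten.counit_surjective.comp (Restr.map_surjective Prod.fst_surjective))

lemma restrExtenProdEquiv_apply {T' : Type u} [AddCommGroup T'] [Module B T']
    (r : Restr k B P₀ (Exten k B P₀ T' × simpleS k B P₀)) :
    restrExtenProdEquiv k P₀ T' r = r.val.1.eval := rfl

lemma unit_surjective_extenProd (T' : Type u) [AddCommGroup T'] [Module B T'] :
    Function.Surjective (unit (Exten k B P₀ T' × simpleS k B P₀) :
      _ →ₗ[OnePointExt k B P₀] Exten k B P₀ (Restr k B P₀ _)) := by
  intro f
  refine ⟨(Exten.map (restrExtenProdEquiv k P₀ T').toLinearMap f, 0), Exten.ext fun q => ?_⟩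
  apply (restrExtenProdEquiv k P₀ T').injective
  rw [toHom_unit, restrExtenProdEquiv_apply, Restr.val_mk, smul_smul, eB_mul_of_mem q.2]
  change Exten.toHom (Exten.map (restrExtenProdEquiv k P₀ T').toLinearMap f)
    (rightMulEBA q.1 one) = _
  rw [rightMulEBA_one]
  rfl

/-- As `e_B A` is a direct summand of some `Bⁿ`, the module `ℰ T' = Hom_B(e_B A, T')` is a direct
summand of `T'ⁿ` over `End_B T'`. -/
lemma exists_pi_exten [Module.Finite B P₀] [Module.Projective B P₀] (T' : Type u)
    [AddCommGroup T'] [Module B T'] :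
    ∃ (n : ℕ) (p : (Fin n → T') →+ Exten k B P₀ T'), Function.Surjective p ∧
      ∀ (a : Module.End B T') v, p (a • v) = Exten.map a (p v) := by
  obtain ⟨n, π, hπ⟩ := Module.Finite.exists_fin' B (eBA k B P₀)
  obtain ⟨s, hs⟩ := Module.projective_lifting_property π LinearMap.id hπ
  refine ⟨n, { toFun := fun v => Exten.toHom.symm (Fintype.linearCombination B v ∘ₗ s)
               map_zero' := Exten.ext fun q => ?_
               map_add' := fun v w => Exten.ext fun q => ?_ }, fun f => ?_, fun a v => ?_⟩
  · change Fintype.linearCombination B (0 : Fin n → T') (s q) = 0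
    simp [Fintype.linearCombination_apply]
  · change Fintype.linearCombination B (v + w) (s q) =
      Fintype.linearCombination B v (s q) + Fintype.linearCombination B w (s q)
    simp [Fintype.linearCombination_apply, Finset.sum_add_distrib]
  · refine ⟨fun i => f.toHom (π (Pi.single i 1)), Exten.ext fun q => ?_⟩
    change Fintype.linearCombination B (fun i => f.toHom (π (Pi.single i 1))) (s q) = f.toHom q
    conv_rhs => rw [← LinearMap.id_apply (R := B) q, ← hs, LinearMap.comp_apply,
      pi_eq_sum_univ' (s q)]
    simp only [Fintype.linearCombination_apply, map_sum, map_smul]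
  · refine Exten.ext fun q => ?_
    change Fintype.linearCombination B (a • v) (s q) = a (Fintype.linearCombination B v (s q))
    simp [Fintype.linearCombination_apply]

lemma isFinendo_extenProd [Module.Finite B P₀] [Module.Projective B P₀] {T' : ModuleCat.{u} B}
    (hT : IsFinendo T') :
    IsFinendo (ModuleCat.of (OnePointExt k B P₀) (Exten k B P₀ T' × simpleS k B P₀)) := by
  classical
  have : Module.Finite (Module.End B T') T' := hT
  obtain ⟨n, p, hp, hpa⟩ := exists_pi_exten (k := k) (B := B) (P₀ := P₀) T'
  let i : (Fin n → T') →+ Exten k B P₀ T' × simpleS k B P₀ := (AddMonoidHom.inl _ _).comp p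
  obtain ⟨s, hs⟩ := exists_finset_span (R := Module.End B T') (M := Fin n → T')
    (S := Module.End (OnePointExt k B P₀) (Exten k B P₀ T' × simpleS k B P₀))
    i fun a => ⟨(Exten.map a).prodMap 0, fun v => by
      refine Prod.ext ?_ ?_
      · exact hpa a v
      · rfl⟩
  let j : k →+ Exten k B P₀ T' × simpleS k B P₀ := AddMonoidHom.inr (Exten k B P₀ T') k
  let m (c : k) : simpleS k B P₀ →ₗ[OnePointExt k B P₀] simpleS k B P₀ :=
    { toFun := fun (x : k) => c * x
      map_add' := fun x y => mul_add (R := k) c x y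
      map_smul' := fun a x => mul_left_comm (G := k) c a.c x }
  obtain ⟨t, ht⟩ := exists_finset_span (R := k) (M := k)
    (S := Module.End (OnePointExt k B P₀) (Exten k B P₀ T' × simpleS k B P₀)) j
    fun c => ⟨LinearMap.prodMap 0 (m c), fun x => by
      refine Prod.ext ?_ ?_
      · rfl
      · rfl⟩
  refine ⟨s ∪ t, eq_top_iff.2 fun x _ => ?_⟩
  obtain ⟨v, hv⟩ := hp x.1
  have hx : x = i v + j x.2 :=
    Prod.ext (hv.symm.trans (add_zero _).symm) (zero_add (M := k) x.2).symm
  rw [hx, Finset.coe_union, Submodule.span_union]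
  exact add_mem (Submodule.mem_sup_left (hs v)) (Submodule.mem_sup_right (ht x.2))

lemma isQuasiTilting_extenProd [Module.Finite B P₀] [Module.Projective B P₀]
    {T' : ModuleCat.{u} B} (hT : IsQuasiTilting T') :
    IsQuasiTilting
      (ModuleCat.of (OnePointExt k B P₀) (Exten k B P₀ T' × simpleS k B P₀)) := by
  rw [isQuasiTilting_iff] at hT ⊢
  intro X hX
  have hu := unit_surjective_of_gen hX (unit_surjective_extenProd (B := B) (k := k) (P₀ := P₀) T')
  let e := restrExtenProdEquiv (B := B) k P₀ T'
  have hN : Gen T' (ModuleCat.of B (Restr k B P₀ X)) := by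
    obtain ⟨M, f, hM, hf⟩ := hX
    exact ⟨_, Restr.map f, addOf_mono e.toLinearMap e.symm.toLinearMap
      (LinearMap.ext fun x => e.symm_apply_apply x) (Restr.addOf hM), Restr.map_surjective hf⟩
  obtain ⟨hext, M₁, M₀, f, g, h₁, h₀, hfg, hg⟩ := hT _ hN
  refine ⟨extVanishes_of_restr hu (hext.congr_left e.symm), ?_⟩
  -- The kernel `K` of the unit of `X` is injective, so `X ≅ K ⊕ ℰℛ X`, and `K ∈ Add S`.
  let K := LinearMap.ker (unit X : X →ₗ[OnePointExt k B P₀] Exten k B P₀ (Restr k B P₀ X))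
  have hK : ∀ x : K, eB k B P₀ • x = 0 := fun x => Subtype.ext (eB_smul_of_unit_eq_zero x.2)
  obtain ⟨σ, hσ⟩ := extVanishes_of_eB_smul_eq_zero (Exten k B P₀ (Restr k B P₀ X)) hK X _
    K.subtype (unit X) K.injective_subtype (LinearMap.exact_subtype_ker_map _) LinearMap.id hu
  have hσ' (y) : unit X (σ y) = y := LinearMap.congr_fun hσ y
  have hadd {M : ModuleCat.{u} B} (hM : AddOf T' M) :
      AddOf (ModuleCat.of (OnePointExt k B P₀) (Exten k B P₀ T' × simpleS k B P₀))
        (ModuleCat.of (OnePointExt k B P₀) (Exten k B P₀ M)) :=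
    addOf_mono (LinearMap.inl _ _ _) (LinearMap.fst _ _ _) (LinearMap.fst_comp_inl _ _ _)
      (Exten.addOf hM)
  have hKadd : AddOf (ModuleCat.of (OnePointExt k B P₀) (Exten k B P₀ T' × simpleS k B P₀))
      (ModuleCat.of (OnePointExt k B P₀) K) :=
    addOf_mono (LinearMap.inr _ _ _) (LinearMap.snd _ _ _) (LinearMap.snd_comp_inr _ _ _)
      (addOf_simpleS _ hK)
  refine ⟨_, _, LinearMap.inl _ (Exten k B P₀ M₀) K ∘ₗ Exten.map f,
    (σ ∘ₗ Exten.map g).coprod K.subtype, hadd h₁, addOf_prod (hadd h₀) hKadd, ?_, ?_⟩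
  · rintro ⟨y, κ⟩
    have hsum : unit X (σ (Exten.map g y) + κ.1) = Exten.map g y := by
      rw [map_add, hσ', show unit X κ.1 = 0 from κ.2, add_zero]
    constructor
    · intro h
      have h' : σ (Exten.map g y) + κ.1 = 0 := h
      have hy : Exten.map g y = 0 := by rw [← hsum, h', map_zero]
      obtain ⟨z, rfl⟩ := (Exten.map_exact hfg y).1 hy
      refine ⟨z, Prod.ext rfl (Subtype.ext ?_)⟩
      rw [hy, map_zero, zero_add] at h'
      exact h'.symm
    · rintro ⟨z, hz⟩
      obtain ⟨rfl, rfl⟩ := Prod.mk.inj hz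
      change σ (Exten.map g (Exten.map f z)) + 0 = 0
      rw [(Exten.map_exact hfg).apply_apply_eq_zero, map_zero, add_zero]
  · intro x
    obtain ⟨y, hy⟩ := Exten.map_surjective (k := k) (P₀ := P₀) hg (unit X x)
    refine ⟨(y, ⟨x - σ (unit X x), ?_⟩), ?_⟩
    · rw [LinearMap.mem_ker, map_sub, hσ', sub_self]
    · change σ (Exten.map g y) + (x - σ (unit X x)) = x
      rw [hy, add_sub_cancel]

end Transfer

end OnePointExt

theorem mainTheorem2 (k B P₀ : Type u) [Field k] [IsAlgClosed k]
    [Ring B] [Algebra k B] [Module.Finite k B]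
    [AddCommGroup P₀] [Module k P₀] [Module B P₀] [IsScalarTower k B P₀]
    [Module.Finite B P₀] [Module.Projective B P₀] :
    (∀ T : ModuleCat.{u} (OnePointExt k B P₀), QuasiTilting.IsFinendoQuasiTilting T →
      QuasiTilting.IsFinendoQuasiTilting ((OnePointExt.restriction k B P₀).obj T)) ∧
    (∀ T' : ModuleCat.{u} B, QuasiTilting.IsFinendoQuasiTilting T' →
      QuasiTilting.IsFinendoQuasiTilting
        (ModuleCat.of (OnePointExt k B P₀)
          ((OnePointExt.extension k B P₀).obj T' × OnePointExt.simpleS k B P₀))) := by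
  exact ⟨fun T hT => ⟨OnePointExt.isFinendo_restr hT.1, OnePointExt.isQuasiTilting_restr hT.2⟩,
    fun T' hT' => ⟨OnePointExt.isFinendo_extenProd hT'.1,
      OnePointExt.isQuasiTilting_extenProd hT'.2⟩⟩
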